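/- Let $H=\ell^2(\mathbb{Z}_+)$ with orthonormal basis $(e_n)_{n\ge 0}$, let $T e_n=e_{n+1}$ be the right shift, and let $\mathcal{T}\subset B(H)$ be the Toeplitz algebra, i.e. the norm closed unital $*$-algebra generated by $T$. Put $T_{n,m}=T^nT^{*m}$ for $n,m\in\mathbb{Z}_+$. Let $\mathcal{T}\otimes\mathcal{T}$ be the minimal $C^*$-tensor product and $\Delta\colon\mathcal{T}\to\mathcal{T}\otimes\mathcal{T}$ the unital $*$-homomorphism with $\Delta(T)=T\otimes T$. On the space $\mathcal{T}^*$ of continuous linear functionals define $(\rho*\varphi)(A)=(\rho\otimes\varphi)(\Delta(A))$. A state $h\in\mathcal{T}^*$ is called a Haar functional if for every $\rho\in\mathcal{T}^*$ there is $\lambda_\rho\in\mathbb{C}$ with $h*\rho=\rho*h=\lambda_\rho h$. There is exactly one Haar functional $h$ in $\mathcal{T}^*$. Let $\rho$ be a faithful state on $\mathcal{T}$ (that is, $\rho(A^*A)=0$ only for $A=0$), and let $\rho_N=\frac1N\sum_{k=1}^N\rho^{*k}$ be the Cesàro means of its convolution powers. Then $$|\rho(T_{n,m})|<1\quad\text{for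 all }(n,m)\neq(0,0),$$ and $$\lim_{N\to\infty}\rho_N=h .$$ The convergence holds on the generators, $$\lim_{N\to\infty}\rho_N(T_{n,m})=h(T_{n,m})=\begin{cases}1,& n=m=0,\\ 0,&(n,m)\ne(0,0),\end{cases}$$ pointwise, $\rho_N(A)\to h(A)$ for every $A\in\mathcal{T}$, and also in the norm of $\mathcal{T}^*$. -/

import Mathlib

open Filter Topology
open scoped ComplexConjugate lp ComplexOrder InnerProductSpace

noncomputable section

namespace Toeplitz

/-- The Hilbert space `l²(ℤ₊)`. -/
abbrev H : Type := ℓ²(ℕ, ℂ)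

/-- The Hilbert space `l²(ℤ₊) ⊗ l²(ℤ₊)`, realised as `l²(ℤ₊ × ℤ₊)`
(the vector `x ⊗ y` is the function `(i, j) ↦ x i * y j`, see `tensorVec`). -/
abbrev HH : Type := ℓ²(ℕ × ℕ, ℂ)

/-! ### Elementary facts on `l²` -/

theorem two_toReal_pos : 0 < (2 : ENNReal).toReal := by norm_num

theorem memlp_two {ι : Type*} {f : ι → ℂ} (hf : Summable fun i => ‖f i‖ ^ 2) :
    Memℓp f 2 := by
  apply memℓp_gen
  simpa using hf

theorem summable_sq {ι : Type*} (f : ℓ²(ι, ℂ)) : Summable fun i => ‖f i‖ ^ 2 := by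
  have h := (lp.memℓp f).summable two_toReal_pos
  simpa using h

theorem norm_sq_eq {ι : Type*} (f : ℓ²(ι, ℂ)) : ‖f‖ ^ 2 = ∑' i, ‖f i‖ ^ 2 := by
  have h := lp.norm_rpow_eq_tsum two_toReal_pos f
  simpa using h

/-! ### The shift and the Toeplitz algebra -/

/-- The value of the right shift on a sequence: `(Tf) 0 = 0`, `(Tf) (n + 1) = f n`. -/
def shiftFun (f : ℕ → ℂ) : ℕ → ℂ
  | 0 => 0
  | n + 1 => f n

theorem shiftFun_summable (f : H) : Summable fun i => ‖shiftFun f i‖ ^ 2 := by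
  rw [← summable_nat_add_iff 1]
  exact summable_sq f

/-- The right shift `T` on `l²(ℤ₊)`, so that `T eₙ = eₙ₊₁`. -/
def shift : H →L[ℂ] H :=
  LinearMap.mkContinuous
    { toFun := fun f => ⟨shiftFun f, memlp_two (shiftFun_summable f)⟩
      map_add' := by
        intro f g
        ext i
        cases i
        · exact (add_zero _).symm
        · rfl
      map_smul' := by
        intro c f
        ext i
        cases i
        · exact (mul_zero _).symm
        · rfl } 1 (by
    intro f
    rw [one_mul]
    refine le_of_eq ((sq_eq_sq₀ (norm_nonneg _) (norm_nonneg _)).1 ?_)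
    rw [norm_sq_eq, norm_sq_eq]
    change ∑' i, ‖shiftFun f i‖ ^ 2 = _
    rw [(shiftFun_summable f).tsum_eq_zero_add]
    simp [shiftFun])

theorem shift_apply (f : H) (i : ℕ) : shift f i = shiftFun f i := rfl

/-- The Toeplitz algebra `𝒯`: the norm closed (unital) star subalgebra of `B(l²(ℤ₊))`
generated by the shift. -/
def 𝒯 : StarSubalgebra ℂ (H →L[ℂ] H) := StarAlgebra.elemental ℂ shift

/-- The generator `T` as an element of `𝒯`. -/
def genT : 𝒯 := ⟨shift, StarAlgebra.elemental.self_mem ℂ shift⟩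

/-- The operators `T_{n,m} = Tⁿ T*ᵐ`. -/
def T (n m : ℕ) : 𝒯 := genT ^ n * star genT ^ m

/-- The dual space `𝒯*` of continuous linear functionals, with its usual norm. -/
abbrev Dual𝒯 : Type := StrongDual ℂ 𝒯

/-! ### Operators acting fibrewise on `l²(ℤ₊ × ℤ₊)` -/

section Fibre

variable {κ : Type} (e : κ × ℕ ≃ ℕ × ℕ)

theorem fibre_summable (f : HH) (k : κ) : Summable fun n => ‖f (e (k, n))‖ ^ 2 :=
  (summable_sq f).comp_injective (i := fun n => e (k, n))
    (fun a b h => by simpa using e.injective h)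

/-- The restriction of `f` to the `k`-th fibre `{e (k, n) | n}` of `ℤ₊ × ℤ₊`. -/
def fibre (f : HH) (k : κ) : H := ⟨fun n => f (e (k, n)), memlp_two (fibre_summable e f k)⟩

theorem fibre_apply (f : HH) (k : κ) (n : ℕ) : fibre e f k n = f (e (k, n)) := rfl

theorem ext_fibre {f g : HH} (h : ∀ k, fibre e f k = fibre e g k) : f = g := by
  ext p
  obtain ⟨⟨k, n⟩, rfl⟩ := e.surjective p
  rw [← fibre_apply, h, fibre_apply]

theorem hasSum_fibre (f : HH) : HasSum (fun k => ‖fibre e f k‖ ^ 2) (‖f‖ ^ 2) := by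
  have h1 : HasSum (fun q : κ × ℕ => ‖f (e q)‖ ^ 2) (‖f‖ ^ 2) := by
    rw [norm_sq_eq]
    exact (e.hasSum_iff (f := fun p => ‖f p‖ ^ 2)).2 (summable_sq f).hasSum
  refine h1.prod_fiberwise fun k => ?_
  rw [norm_sq_eq]
  exact (summable_sq (fibre e f k)).hasSum

theorem hasSum_inner_fibre (f g : HH) :
    HasSum (fun k => ⟪fibre e f k, fibre e g k⟫_ℂ) ⟪f, g⟫_ℂ := by
  have h1 : HasSum (fun q : κ × ℕ => ⟪f (e q), g (e q)⟫_ℂ) ⟪f, g⟫_ℂ :=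
    (e.hasSum_iff (f := fun p => ⟪f p, g p⟫_ℂ)).2 (lp.hasSum_inner f g)
  exact h1.prod_fiberwise fun k => lp.hasSum_inner (fibre e f k) (fibre e g k)

/-- The function obtained by applying the operator `A` on each fibre. -/
def ampFun (A : H →L[ℂ] H) (f : HH) : ℕ × ℕ → ℂ :=
  fun p => A (fibre e f (e.symm p).1) (e.symm p).2

theorem ampFun_summable (A : H →L[ℂ] H) (f : HH) :
    Summable fun p => ‖ampFun e A f p‖ ^ 2 := by
  rw [← e.summable_iff, summable_prod_of_nonneg fun q =>
    show 0 ≤ ((fun p => ‖ampFun e A f p‖ ^ 2) ∘ e) q from sq_nonneg _]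
  refine ⟨fun k => by simpa [ampFun] using summable_sq (A (fibre e f k)), ?_⟩
  have h2 : ∀ k, ∑' n, ((fun p => ‖ampFun e A f p‖ ^ 2) ∘ e) (k, n)
      = ‖A (fibre e f k)‖ ^ 2 := by
    intro k
    rw [norm_sq_eq]
    simp [ampFun]
  simp_rw [h2]
  refine Summable.of_nonneg_of_le (fun _ => by positivity) (fun k => ?_)
    ((hasSum_fibre e f).summable.mul_left (‖A‖ ^ 2))
  rw [← mul_pow]
  exact pow_le_pow_left₀ (norm_nonneg _) (A.le_opNorm _) 2

/-- The operator on `l²(ℤ₊ × ℤ₊)` which acts as `A` on each fibre, as a vector valued map. -/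
def ampVec (A : H →L[ℂ] H) (f : HH) : HH := ⟨ampFun e A f, memlp_two (ampFun_summable e A f)⟩

theorem fibre_ampVec (A : H →L[ℂ] H) (f : HH) (k : κ) :
    fibre e (ampVec e A f) k = A (fibre e f k) := by
  ext n
  rw [fibre_apply]
  change ampFun e A f (e (k, n)) = _
  simp [ampFun]

theorem fibre_add (f g : HH) (k : κ) : fibre e (f + g) k = fibre e f k + fibre e g k := rfl

theorem fibre_smul (c : ℂ) (f : HH) (k : κ) : fibre e (c • f) k = c • fibre e f k := rfl

theorem norm_ampVec_le (A : H →L[ℂ] H) (f : HH) : ‖ampVec e A f‖ ≤ ‖A‖ * ‖f‖ := by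
  refine (sq_le_sq₀ (norm_nonneg _) (by positivity)).1 ?_
  rw [mul_pow]
  refine hasSum_le (fun k => ?_) (hasSum_fibre e (ampVec e A f))
    ((hasSum_fibre e f).mul_left (‖A‖ ^ 2))
  rw [fibre_ampVec, ← mul_pow]
  exact pow_le_pow_left₀ (norm_nonneg _) (A.le_opNorm _) 2

/-- The operator on `l²(ℤ₊ × ℤ₊)` which acts as `A` on each fibre. -/
def ampOp (A : H →L[ℂ] H) : HH →L[ℂ] HH :=
  LinearMap.mkContinuous
    { toFun := ampVec e A
      map_add' := fun f g => ext_fibre e fun k => by simp [fibre_ampVec, fibre_add]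
      map_smul' := fun c f => ext_fibre e fun k => by simp [fibre_ampVec, fibre_smul] }
    ‖A‖ (norm_ampVec_le e A)

theorem fibre_ampOp (A : H →L[ℂ] H) (f : HH) (k : κ) :
    fibre e (ampOp e A f) k = A (fibre e f k) := fibre_ampVec e A f k

theorem norm_ampOp_le (A : H →L[ℂ] H) : ‖ampOp e A‖ ≤ ‖A‖ :=
  LinearMap.mkContinuous_norm_le _ (norm_nonneg _) _

/-- The unital star homomorphism `B(l²(ℤ₊)) → B(l²(ℤ₊ × ℤ₊))` which lets an operator act on
each fibre `{e (k, n) | n ∈ ℤ₊}`. -/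
def amp : (H →L[ℂ] H) →⋆ₐ[ℂ] (HH →L[ℂ] HH) where
  toFun := ampOp e
  map_one' := ContinuousLinearMap.ext fun f => ext_fibre e fun k => by simp [fibre_ampOp]
  map_mul' A B := ContinuousLinearMap.ext fun f => ext_fibre e fun k => by simp [fibre_ampOp]
  map_zero' := ContinuousLinearMap.ext fun f => ext_fibre e fun k => by
    rw [fibre_ampOp]; rfl
  map_add' A B := ContinuousLinearMap.ext fun f => ext_fibre e fun k => by
    simp [fibre_ampOp, fibre_add]
  commutes' c := ContinuousLinearMap.ext fun f => ext_fibre e fun k => by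
    rw [fibre_ampOp]; simp [Algebra.algebraMap_eq_smul_one, fibre_smul]
  map_star' A := by
    rw [ContinuousLinearMap.star_eq_adjoint, ContinuousLinearMap.star_eq_adjoint,
      ContinuousLinearMap.eq_adjoint_iff]
    intro f g
    refine (hasSum_inner_fibre e _ g).unique ?_
    have h := hasSum_inner_fibre e f (ampOp e A g)
    simpa only [fibre_ampOp, ContinuousLinearMap.adjoint_inner_left] using h

theorem fibre_amp (A : H →L[ℂ] H) (f : HH) (k : κ) :
    fibre e (amp e A f) k = A (fibre e f k) := fibre_ampOp e A f k

theorem continuous_amp : Continuous (amp e) :=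
  AddMonoidHomClass.continuous_of_bound (amp e) 1 fun A => by
    rw [one_mul]; exact norm_ampOp_le e A

end Fibre

/-! ### The minimal tensor product `𝒯 ⊗ 𝒯` -/

/-- The operator `A ⊗ B` on `l²(ℤ₊) ⊗ l²(ℤ₊)`, as the product of `A ⊗ 1` (acting in the first
variable) and `1 ⊗ B` (acting in the second variable). -/
def tensorOp (A B : H →L[ℂ] H) : HH →L[ℂ] HH :=
  amp (Equiv.prodComm ℕ ℕ) A * amp (Equiv.refl (ℕ × ℕ)) B

/-- The minimal (spatial) C*-tensor product `𝒯 ⊗ 𝒯`: the norm closed star subalgebra of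
`B(l²(ℤ₊) ⊗ l²(ℤ₊))` generated by the operators `a ⊗ b`, `a, b ∈ 𝒯`. -/
def 𝒯𝒯 : StarSubalgebra ℂ (HH →L[ℂ] HH) :=
  (StarAlgebra.adjoin ℂ {X | ∃ a b : 𝒯, X = tensorOp a b}).topologicalClosure

theorem tensorOp_mem (a b : 𝒯) : tensorOp a b ∈ 𝒯𝒯 :=
  StarSubalgebra.le_topologicalClosure _ (StarAlgebra.subset_adjoin ℂ _ ⟨a, b, rfl⟩)

/-- The elementary tensor `a ⊗ b ∈ 𝒯 ⊗ 𝒯`. -/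
def tmul (a b : 𝒯) : 𝒯𝒯 := ⟨tensorOp a b, tensorOp_mem a b⟩

theorem tensorVec_hasSum (x y : H) :
    HasSum (fun p : ℕ × ℕ => ‖x p.1 * y p.2‖ ^ 2) (‖x‖ ^ 2 * ‖y‖ ^ 2) := by
  have h := (summable_sq x).mul_of_nonneg (summable_sq y)
    (fun _ => by positivity) (fun _ => by positivity)
  have h2 := (summable_sq x).hasSum.mul (summable_sq y).hasSum h
  rw [← norm_sq_eq, ← norm_sq_eq] at h2
  simpa only [norm_mul, mul_pow] using h2

/-- The vector `x ⊗ y ∈ l²(ℤ₊) ⊗ l²(ℤ₊)`. -/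
def tensorVec (x y : H) : HH :=
  ⟨fun p => x p.1 * y p.2, memlp_two (tensorVec_hasSum x y).summable⟩

theorem tensorVec_apply (x y : H) (p : ℕ × ℕ) : tensorVec x y p = x p.1 * y p.2 := rfl

theorem norm_tensorVec (x y : H) : ‖tensorVec x y‖ = ‖x‖ * ‖y‖ := by
  refine (sq_eq_sq₀ (norm_nonneg _) (by positivity)).1 ?_
  rw [mul_pow, norm_sq_eq]
  exact (tensorVec_hasSum x y).tsum_eq

theorem amp_snd_tensorVec (B : H →L[ℂ] H) (x y : H) :
    amp (Equiv.refl (ℕ × ℕ)) B (tensorVec x y) = tensorVec x (B y) := by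
  refine ext_fibre (Equiv.refl (ℕ × ℕ)) fun k => ?_
  have h : ∀ z : H, fibre (Equiv.refl (ℕ × ℕ)) (tensorVec x z) k = x k • z := fun z => rfl
  rw [fibre_amp, h, h, map_smul]

theorem amp_fst_tensorVec (A : H →L[ℂ] H) (x y : H) :
    amp (Equiv.prodComm ℕ ℕ) A (tensorVec x y) = tensorVec (A x) y := by
  refine ext_fibre (Equiv.prodComm ℕ ℕ) fun k => ?_
  have h : ∀ z : H, fibre (Equiv.prodComm ℕ ℕ) (tensorVec z y) k = y k • z := by
    intro z
    ext n
    exact mul_comm _ _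
  rw [fibre_amp, h, h, map_smul]

/-- The operators `A ⊗ B` are the usual ones: `(A ⊗ B) (x ⊗ y) = Ax ⊗ By`. -/
theorem tensorOp_tensorVec (A B : H →L[ℂ] H) (x y : H) :
    tensorOp A B (tensorVec x y) = tensorVec (A x) (B y) := by
  rw [tensorOp, mul_apply_eq_comp, amp_snd_tensorVec, amp_fst_tensorVec]

theorem ext_tensorVec {X Y : HH →L[ℂ] HH}
    (h : ∀ x y, X (tensorVec x y) = Y (tensorVec x y)) : X = Y := by
  refine lp.ext_continuousLinearMap (by norm_num) fun p => ContinuousLinearMap.ext_ring ?_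
  have hp : lp.single (E := fun _ : ℕ × ℕ => ℂ) 2 p (1 : ℂ)
      = tensorVec (lp.single 2 p.1 1) (lp.single 2 p.2 1) := by
    ext q
    rw [tensorVec_apply, lp.single_apply, lp.single_apply, lp.single_apply]
    simp only [Pi.single_apply, Prod.ext_iff]
    split_ifs <;> simp_all
  change X (lp.single 2 p 1) = Y (lp.single 2 p 1)
  rw [hp, h]

/-! ### The tensor product of two functionals -/

/-- The operator `y ↦ x ⊗ y`, linearly in `x`. -/
def tensorVecL : H →L[ℂ] H →L[ℂ] HH :=
  LinearMap.mkContinuous₂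
    (LinearMap.mk₂ ℂ tensorVec
      (fun x x' y => by ext p; exact add_mul _ _ _)
      (fun c x y => by ext p; exact mul_assoc _ _ _)
      (fun x y y' => by ext p; exact mul_add _ _ _)
      (fun c x y => by ext p; exact mul_left_comm _ _ _)) 1
    (fun x y => by rw [one_mul]; exact (norm_tensorVec x y).le)

theorem tensorVecL_apply (x y : H) : tensorVecL x y = tensorVec x y := rfl

theorem norm_tensorVecL_le (x : H) : ‖tensorVecL x‖ ≤ ‖x‖ :=
  ContinuousLinearMap.opNorm_le_bound _ (norm_nonneg _) fun y => by
    rw [tensorVecL_apply, norm_tensorVec]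

/-- The slice `(⟨v, · w⟩ ⊗ id) X ∈ B(l²(ℤ₊))` of an operator `X` on `l²(ℤ₊) ⊗ l²(ℤ₊)`. -/
def vecSlice (X : HH →L[ℂ] HH) (v w : H) : H →L[ℂ] H :=
  ContinuousLinearMap.adjoint (tensorVecL v) ∘L X ∘L tensorVecL w

theorem norm_vecSlice_le (X : HH →L[ℂ] HH) (v w : H) :
    ‖vecSlice X v w‖ ≤ ‖X‖ * ‖w‖ * ‖v‖ := by
  refine (ContinuousLinearMap.opNorm_comp_le _ _).trans ?_
  rw [LinearIsometryEquiv.norm_map, mul_comm]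
  refine mul_le_mul ((ContinuousLinearMap.opNorm_comp_le _ _).trans ?_)
    (norm_tensorVecL_le v) (norm_nonneg _) (by positivity)
  exact mul_le_mul_of_nonneg_left (norm_tensorVecL_le w) (norm_nonneg _)

theorem inner_tensorVec (v z x y : H) :
    ⟪tensorVec v z, tensorVec x y⟫_ℂ = ⟪v, x⟫_ℂ * ⟪z, y⟫_ℂ := by
  refine (hasSum_inner_fibre (Equiv.refl (ℕ × ℕ)) _ _).unique ?_
  have h : ∀ (x y : H) k, fibre (Equiv.refl (ℕ × ℕ)) (tensorVec x y) k = x k • y :=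
    fun x y k => rfl
  have h2 := (lp.hasSum_inner v x).mul_right ⟪z, y⟫_ℂ
  have h3 : ∀ k, ⟪fibre (Equiv.refl (ℕ × ℕ)) (tensorVec v z) k,
      fibre (Equiv.refl (ℕ × ℕ)) (tensorVec x y) k⟫_ℂ = ⟪v k, x k⟫_ℂ * ⟪z, y⟫_ℂ := by
    intro k
    rw [h, h, inner_smul_left, inner_smul_right, ← mul_assoc]
    congr 1
    exact mul_comm _ _
  simp_rw [h3]
  exact h2

theorem vecSlice_tensorOp (A B : H →L[ℂ] H) (v w : H) :
    vecSlice (tensorOp A B) v w = ⟪v, A w⟫_ℂ • B := by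
  ext1 y
  refine ext_inner_left ℂ fun z => ?_
  simp only [vecSlice, ContinuousLinearMap.comp_apply, ContinuousLinearMap.adjoint_inner_right,
    tensorVecL_apply, tensorOp_tensorVec, inner_tensorVec]
  exact (inner_smul_right _ _ _).symm

section Slice

variable (φ : StrongDual ℂ (H →L[ℂ] H))

/-- The functional `v ↦ conj (φ ((⟨v, · w⟩ ⊗ id) X))`. -/
def sliceForm (X : HH →L[ℂ] HH) (w : H) : StrongDual ℂ H :=
  LinearMap.mkContinuous
    { toFun := fun v => conj (φ (vecSlice X v w))
      map_add' := fun v v' => by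
        simp only [vecSlice, map_add, ContinuousLinearMap.add_comp]
      map_smul' := fun c v => by
        simp only [vecSlice, map_smul, map_smulₛₗ, ContinuousLinearMap.smul_comp, smul_eq_mul,
          map_mul, Complex.conj_conj, RingHom.id_apply] }
    (‖φ‖ * (‖X‖ * ‖w‖)) (fun v => by
      change ‖conj (φ (vecSlice X v w))‖ ≤ _
      rw [RCLike.norm_conj, mul_assoc]
      exact φ.le_opNorm_of_le (norm_vecSlice_le X v w))

theorem sliceForm_apply (X : HH →L[ℂ] HH) (v w : H) :
    sliceForm φ X w v = conj (φ (vecSlice X v w)) := rfl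

/-- The vector `((id ⊗ φ) X) w`. -/
def sliceVec (X : HH →L[ℂ] HH) (w : H) : H := (InnerProductSpace.toDual ℂ H).symm (sliceForm φ X w)

theorem inner_sliceVec (X : HH →L[ℂ] HH) (v w : H) :
    ⟪v, sliceVec φ X w⟫_ℂ = φ (vecSlice X v w) := by
  rw [← inner_conj_symm, sliceVec, InnerProductSpace.toDual_symm_apply, sliceForm_apply,
    Complex.conj_conj]

theorem norm_sliceVec_le (X : HH →L[ℂ] HH) (w : H) :
    ‖sliceVec φ X w‖ ≤ ‖φ‖ * ‖X‖ * ‖w‖ := by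
  rw [sliceVec, LinearIsometryEquiv.norm_map, mul_assoc]
  exact LinearMap.mkContinuous_norm_le _ (by positivity) _

/-- The slice map `id ⊗ φ : B(l²(ℤ₊) ⊗ l²(ℤ₊)) → B(l²(ℤ₊))`. -/
def slice : (HH →L[ℂ] HH) →L[ℂ] H →L[ℂ] H :=
  LinearMap.mkContinuous₂
    (LinearMap.mk₂ ℂ (sliceVec φ)
      (fun X X' w => ext_inner_left ℂ fun v => by
        simp only [inner_add_right, inner_sliceVec, vecSlice, ContinuousLinearMap.add_comp,
          ContinuousLinearMap.comp_add, map_add])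
      (fun c X w => ext_inner_left ℂ fun v => by
        simp only [inner_smul_right, inner_sliceVec, vecSlice, ContinuousLinearMap.smul_comp,
          ContinuousLinearMap.comp_smul, map_smul, smul_eq_mul])
      (fun X w w' => ext_inner_left ℂ fun v => by
        simp only [inner_add_right, inner_sliceVec, vecSlice, ContinuousLinearMap.comp_add,
          map_add])
      (fun c X w => ext_inner_left ℂ fun v => by
        simp only [inner_smul_right, inner_sliceVec, vecSlice, ContinuousLinearMap.comp_smul,
          map_smul, smul_eq_mul])) ‖φ‖
    (fun X w => norm_sliceVec_le φ X w)

theorem slice_tensorOp (A B : H →L[ℂ] H) : slice φ (tensorOp A B) = φ B • A := by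
  ext1 w
  refine ext_inner_left ℂ fun v => ?_
  have h : ⟪v, slice φ (tensorOp A B) w⟫_ℂ = φ (vecSlice (tensorOp A B) v w) :=
    inner_sliceVec φ _ _ _
  rw [h, vecSlice_tensorOp, map_smul, smul_eq_mul, mul_comm]
  exact (inner_smul_right _ _ _).symm

theorem norm_slice_le : ‖slice φ‖ ≤ ‖φ‖ :=
  LinearMap.mkContinuous₂_norm_le _ (norm_nonneg φ) _

end Slice

/-- For `ρ, φ ∈ 𝒯*` there is a bounded functional on `𝒯 ⊗ 𝒯` with `a ⊗ b ↦ ρ a * φ b`. -/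
theorem exists_tensorFunctional (ρ φ : Dual𝒯) :
    ∃ F : StrongDual ℂ 𝒯𝒯, (∀ a b, F (tmul a b) = ρ a * φ b) ∧ ‖F‖ ≤ ‖ρ‖ * ‖φ‖ := by
  obtain ⟨ρ', h1, h2⟩ := exists_extension_norm_eq (𝕜 := ℂ) 𝒯.toSubalgebra.toSubmodule ρ
  obtain ⟨φ', h3, h4⟩ := exists_extension_norm_eq (𝕜 := ℂ) 𝒯.toSubalgebra.toSubmodule φ
  refine ⟨(ρ' ∘L slice φ') ∘L 𝒯𝒯.toSubalgebra.toSubmodule.subtypeL, fun a b => ?_, ?_⟩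
  · change ρ' (slice φ' (tensorOp a b)) = _
    rw [slice_tensorOp, map_smul, smul_eq_mul, mul_comm]
    exact congrArg₂ _ (h1 a) (h3 b)
  · refine ContinuousLinearMap.opNorm_le_bound _ (mul_nonneg (norm_nonneg ρ) (norm_nonneg φ))
      fun X => ?_
    change ‖ρ' (slice φ' (X : HH →L[ℂ] HH))‖ ≤ ‖ρ‖ * ‖φ‖ * ‖(X : HH →L[ℂ] HH)‖
    rw [mul_assoc]
    refine (ρ'.le_opNorm_of_le ((slice φ').le_of_opNorm_le (norm_slice_le φ') _)).trans ?_
    rw [h2, h4]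
    exact le_rfl

/-- The functional `ρ ⊗ φ` on `𝒯 ⊗ 𝒯`: the bounded functional with `a ⊗ b ↦ ρ a * φ b`. -/
def tensorFunctional (ρ φ : Dual𝒯) : StrongDual ℂ 𝒯𝒯 :=
  (exists_tensorFunctional ρ φ).choose

theorem tensorFunctional_tmul (ρ φ : Dual𝒯) (a b : 𝒯) :
    tensorFunctional ρ φ (tmul a b) = ρ a * φ b :=
  (exists_tensorFunctional ρ φ).choose_spec.1 a b

theorem norm_tensorFunctional_le (ρ φ : Dual𝒯) : ‖tensorFunctional ρ φ‖ ≤ ‖ρ‖ * ‖φ‖ :=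
  (exists_tensorFunctional ρ φ).choose_spec.2

theorem tensorOp_mul (A B A' B' : H →L[ℂ] H) :
    tensorOp A B * tensorOp A' B' = tensorOp (A * A') (B * B') :=
  ext_tensorVec fun x y => by
    simp only [mul_apply_eq_comp, tensorOp_tensorVec]

theorem tensorOp_star (A B : H →L[ℂ] H) :
    star (tensorOp A B) = tensorOp (star A) (star B) :=
  ext_tensorVec fun x y => by
    rw [tensorOp_tensorVec, tensorOp, star_mul, ← map_star, ← map_star, mul_apply_eq_comp,
      amp_fst_tensorVec, amp_snd_tensorVec]

theorem tensorOp_one : tensorOp 1 1 = 1 :=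
  ext_tensorVec fun x y => by rw [tensorOp_tensorVec]; rfl

/-- Bounded functionals on `𝒯 ⊗ 𝒯` are determined by their values on elementary tensors. -/
theorem ext_tmul {F G : StrongDual ℂ 𝒯𝒯} (h : ∀ a b, F (tmul a b) = G (tmul a b)) : F = G := by
  let S : Submonoid (HH →L[ℂ] HH) :=
    { carrier := {X | ∃ a b : 𝒯, X = tensorOp a b}
      one_mem' := ⟨1, 1, tensorOp_one.symm⟩
      mul_mem' := by
        rintro _ _ ⟨a, b, rfl⟩ ⟨c, d, rfl⟩
        exact ⟨a * c, b * d, tensorOp_mul _ _ _ _⟩ }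
  have hS : {X | ∃ a b : 𝒯, X = tensorOp a b} ∪ star {X | ∃ a b : 𝒯, X = tensorOp a b}
      = (S : Set (HH →L[ℂ] HH)) := by
    refine Set.union_eq_left.2 ?_
    rintro X ⟨a, b, hX⟩
    exact ⟨star a, star b, by rw [← star_star X, hX, tensorOp_star]; rfl⟩
  have hcl : IsClosed (Subtype.val '' {X : 𝒯𝒯 | F X = G X}) :=
    (StarSubalgebra.isClosed_topologicalClosure _).isClosedMap_subtype_val _
      (isClosed_eq F.continuous G.continuous)
  have hsub : ∀ X ∈ StarAlgebra.adjoin ℂ {X | ∃ a b : 𝒯, X = tensorOp a b},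
      X ∈ Subtype.val '' {X : 𝒯𝒯 | F X = G X} := by
    intro X hX
    replace hX : X ∈ Submodule.span ℂ (S : Set (HH →L[ℂ] HH)) := by
      have h2 := StarAlgebra.adjoin_eq_span (R := ℂ) {X | ∃ a b : 𝒯, X = tensorOp a b}
      rw [hS, Submonoid.closure_eq] at h2
      rw [← h2]
      exact hX
    induction hX using Submodule.span_induction with
    | mem X hX =>
      obtain ⟨a, b, rfl⟩ := hX
      exact ⟨tmul a b, h a b, rfl⟩
    | zero => exact ⟨0, by simp, rfl⟩
    | add X Y _ _ h1 h2 =>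
      obtain ⟨X, hX, rfl⟩ := h1
      obtain ⟨Y, hY, rfl⟩ := h2
      refine ⟨X + Y, ?_, rfl⟩
      change F (X + Y) = G (X + Y)
      rw [map_add, map_add]
      exact congrArg₂ _ hX hY
    | smul c X _ h1 =>
      obtain ⟨X, hX, rfl⟩ := h1
      refine ⟨c • X, ?_, rfl⟩
      change F (c • X) = G (c • X)
      rw [map_smul, map_smul]
      exact congrArg _ hX
  ext ⟨X, hX⟩
  obtain ⟨Y, hY, hYX⟩ := closure_minimal hsub hcl hX
  obtain rfl : Y = ⟨X, hX⟩ := Subtype.ext hYX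
  exact hY

/-! ### The comultiplication -/

/-- The decomposition of `ℤ₊ × ℤ₊` into diagonals: `(d, n) ↦ (n + d⁺, n + d⁻)`. -/
def diagEquiv : ℤ × ℕ ≃ ℕ × ℕ where
  toFun q := (q.2 + q.1.toNat, q.2 + (-q.1).toNat)
  invFun p := ((p.1 : ℤ) - p.2, min p.1 p.2)
  left_inv q := by
    ext <;> dsimp only <;> omega
  right_inv p := by
    ext <;> dsimp only <;> omega

theorem amp_diag_shift : amp diagEquiv shift = tensorOp shift shift := by
  refine ext_tensorVec fun x y => ext_fibre diagEquiv fun k => ?_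
  rw [tensorOp_tensorVec, fibre_amp]
  ext n
  rw [shift_apply, fibre_apply, tensorVec_apply, shift_apply, shift_apply]
  cases n with
  | zero =>
    change 0 = shiftFun x (0 + k.toNat) * shiftFun y (0 + (-k).toNat)
    rcases le_total k 0 with hk | hk
    · rw [Int.toNat_of_nonpos hk]
      exact (zero_mul _).symm
    · rw [Int.toNat_of_nonpos (neg_nonpos.2 hk)]
      exact (mul_zero _).symm
  | succ n =>
    change x (n + k.toNat) * y (n + (-k).toNat)
      = shiftFun x (n + 1 + k.toNat) * shiftFun y (n + 1 + (-k).toNat)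
    rw [add_right_comm n 1, add_right_comm n 1]
    rfl

theorem amp_diag_mem (a : 𝒯) : amp diagEquiv a ∈ 𝒯𝒯 := by
  have h : 𝒯 ≤ 𝒯𝒯.comap (amp diagEquiv) := by
    refine StarAlgebra.elemental.le_of_mem ?_ ?_
    · exact (StarSubalgebra.isClosed_topologicalClosure _).preimage (continuous_amp diagEquiv)
    · change amp diagEquiv shift ∈ 𝒯𝒯
      rw [amp_diag_shift]
      exact tensorOp_mem genT genT
  exact h a.2

/-- The comultiplication `Δ : 𝒯 → 𝒯 ⊗ 𝒯`: the unital star homomorphism with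
`Δ(T) = T ⊗ T` (see `comul_genT`), which is unique since `T` generates `𝒯` (see `comul_unique`).
The operator `T ⊗ T` moves `(i, j)` to `(i + 1, j + 1)`, i.e. it acts as a copy of the shift on
each diagonal of `ℤ₊ × ℤ₊`, and `Δ(A)` acts as a copy of `A` on each diagonal. -/
def comul : 𝒯 →⋆ₐ[ℂ] 𝒯𝒯 :=
  StarAlgHom.codRestrict ((amp diagEquiv).comp 𝒯.subtype) 𝒯𝒯 amp_diag_mem

theorem continuous_comul : Continuous comul :=
  ((continuous_amp diagEquiv).comp continuous_subtype_val).subtype_mk _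

theorem comul_genT : comul genT = tmul genT genT := Subtype.ext amp_diag_shift

theorem comul_unique (D : 𝒯 →⋆ₐ[ℂ] 𝒯𝒯) (hc : Continuous D) (hD : D genT = tmul genT genT) :
    D = comul :=
  StarAlgebra.elemental.starAlgHomClass_ext ℂ hc continuous_comul (hD.trans comul_genT.symm)

theorem comul_T (n m : ℕ) : comul (T n m) = tmul (T n m) (T n m) := by
  have hmul : ∀ a b c d : 𝒯, tmul a b * tmul c d = tmul (a * c) (b * d) :=
    fun a b c d => Subtype.ext (tensorOp_mul _ _ _ _)
  have hstar : ∀ a b : 𝒯, star (tmul a b) = tmul (star a) (star b) :=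
    fun a b => Subtype.ext (tensorOp_star _ _)
  have hpow : ∀ (a : 𝒯) (k : ℕ), tmul a a ^ k = tmul (a ^ k) (a ^ k) := by
    intro a k
    induction k with
    | zero => exact Subtype.ext tensorOp_one.symm
    | succ k ih => rw [pow_succ, ih, hmul, ← pow_succ]
  rw [T, map_mul, map_pow, map_pow, map_star, comul_genT, hstar, hpow, hpow, hmul]

/-- `Δ` as a bounded linear map. -/
def comulL : 𝒯 →L[ℂ] 𝒯𝒯 := ⟨comul.toAlgHom.toLinearMap, continuous_comul⟩

/-! ### The dual algebra -/

/-- The product of functionals: `(ρ ∗ φ)(A) = (ρ ⊗ φ)(Δ(A))`. -/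
def conv (ρ φ : Dual𝒯) : Dual𝒯 := (tensorFunctional ρ φ).comp comulL

theorem conv_apply (ρ φ : Dual𝒯) (a : 𝒯) :
    conv ρ φ a = tensorFunctional ρ φ (comul a) := rfl

/-- The convolution powers: `convPowSucc ρ n = ρ^{∗(n+1)}`, the product of `n + 1` factors `ρ`. -/
def convPowSucc (ρ : Dual𝒯) : ℕ → Dual𝒯
  | 0 => ρ
  | n + 1 => conv (convPowSucc ρ n) ρ

/-- The Cesàro means `ρₙ = (1/n) ∑_{k=1}^n ρ^{∗k}`, for `n ≥ 1`. The summation index is shifted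
by one: the `k`-th summand below is `ρ^{∗(k+1)}`. -/
def cesaro (ρ : Dual𝒯) (n : ℕ) : Dual𝒯 :=
  (n : ℂ)⁻¹ • ∑ k ∈ Finset.range n, convPowSucc ρ k

/-- States: positive functionals of value `1` at the unit. -/
def IsState (ρ : Dual𝒯) : Prop := (∀ a : 𝒯, 0 ≤ ρ (star a * a)) ∧ ρ 1 = 1

/-- Faithfulness of a functional: `ρ(a*a) = 0` only for `a = 0`. -/
def IsFaithful (ρ : Dual𝒯) : Prop := ∀ a : 𝒯, ρ (star a * a) = 0 → a = 0

/-- Haar functionals in `𝒯*`: states `h` such that `h ∗ ρ = ρ ∗ h = λ_ρ h` for every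
`ρ ∈ 𝒯*`, with a scalar `λ_ρ`. -/
def IsHaarFunctional (h : Dual𝒯) : Prop :=
  IsState h ∧ ∀ ρ : Dual𝒯, ∃ c : ℂ, conv h ρ = c • h ∧ conv ρ h = c • h

end Toeplitz

end

/-!
Since `Δ(T_{n,m}) = T_{n,m} ⊗ T_{n,m}` and the `T_{n,m}` span a dense subspace, convolution
multiplies the coefficients `ρ(T_{n,m})`, and the Haar functional is the vacuum state
`A ↦ ⟨e₀, A e₀⟩`, whose only nonzero coefficient is the one at `(0,0)`. By Cauchy–Schwarz
`|ρ(T_{n,m})|² ≤ ρ(T_{n,n}) ρ(T_{m,m})`, and `ρ(T_{n,n}) ≤ ρ(T_{1,1}) < 1` for `n ≥ 1` when `ρ` is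
faithful, because `1 - T_{1,1}` is a nonzero projection. This gives convergence of `ρ^{∗k}` on the
generators.

For convergence in norm, let `Pₙ = 1 - T_{n,n}` and `τ = ρ - ρ(Pₙ · Pₙ)`. Again by Cauchy–Schwarz,
`‖τ‖ ≤ ρ(T_{n,n}) + 2 √(ρ(T_{n,n}) - c)` with `c = inf ρ(T_{m,m}) < 1`, so that `‖τ‖ < 1` for large
`n` and `τ^{∗k} → 0` by submultiplicativity of the norm. As `Pₙ T_{a,b} Pₙ = 0` unless `a, b < n`,
the differences `ρ^{∗k} - τ^{∗k}` lie in a fixed finite-dimensional space of functionals, where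
convergence on the generators is convergence in norm.
-/

namespace Toeplitz

section Monoid

variable {M : Type*} [Monoid M] {s t : M}

theorem pow_mul_pow_of_mul_eq_one (h : s * t = 1) (m n : ℕ) :
    s ^ m * t ^ n = t ^ (n - m) * s ^ (m - n) := by
  rcases le_total m n with hmn | hmn
  · obtain ⟨k, rfl⟩ := Nat.exists_eq_add_of_le hmn
    simp [pow_add, ← mul_assoc, pow_mul_pow_eq_one m h]
  · obtain ⟨k, rfl⟩ := Nat.exists_eq_add_of_le' hmn
    simp [pow_add, mul_assoc, pow_mul_pow_eq_one n h]

theorem pow_mul_pow_mul_pow_mul_pow_of_mul_eq_one (h : s * t = 1) (a b c d : ℕ) :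
    t ^ a * s ^ b * (t ^ c * s ^ d) = t ^ (a + (c - b)) * s ^ (b - c + d) := by
  rw [pow_add, pow_add, mul_assoc, ← mul_assoc (s ^ b), pow_mul_pow_of_mul_eq_one h]
  simp only [mul_assoc]

theorem closure_pair_subset_range (h : s * t = 1) :
    (Submonoid.closure {t, s} : Set M) ⊆ Set.range fun p : ℕ × ℕ => t ^ p.1 * s ^ p.2 := by
  let words : Submonoid M :=
    { carrier := Set.range fun p : ℕ × ℕ => t ^ p.1 * s ^ p.2
      one_mem' := ⟨(0, 0), by simp⟩
      mul_mem' := by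
        rintro _ _ ⟨⟨a, b⟩, rfl⟩ ⟨⟨c, d⟩, rfl⟩
        exact ⟨(a + (c - b), b - c + d),
          (pow_mul_pow_mul_pow_mul_pow_of_mul_eq_one h a b c d).symm⟩ }
  have hle : Submonoid.closure {t, s} ≤ words :=
    Submonoid.closure_le.2 (Set.pair_subset ⟨(1, 0), by simp⟩ ⟨(0, 1), by simp⟩)
  exact hle

end Monoid

theorem adjoin_singleton_le_span_of_star_mul_self {R A : Type*} [CommSemiring R] [StarRing R]
    [Semiring A] [StarRing A] [Algebra R A] [StarModule R A] {t : A} (h : star t * t = 1) :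
    Subalgebra.toSubmodule (StarAlgebra.adjoin R {t}).toSubalgebra ≤
      Submodule.span R (Set.range fun p : ℕ × ℕ => t ^ p.1 * star t ^ p.2) := by
  rw [StarAlgebra.adjoin_eq_span, Set.star_singleton, Set.singleton_union]
  exact Submodule.span_mono (closure_pair_subset_range h)

/-! ### Positive functionals on C*-algebras -/

theorem apply_nonneg_of_isStarProjection {R F : Type*} [Mul R] [Star R] [FunLike F R ℂ] {φ : F}
    (hφ : ∀ a, 0 ≤ φ (star a * a)) {p : R} (hp : IsStarProjection p) : 0 ≤ φ p := by
  simpa only [hp.isSelfAdjoint.star_eq, hp.isIdempotentElem.eq] using hφ p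

section PositiveFunctional

variable {A F : Type*} [CStarAlgebra A] [FunLike F A ℂ] [LinearMapClass F ℂ A ℂ] {φ : F}

attribute [local instance] CStarAlgebra.spectralOrder CStarAlgebra.spectralOrderedRing

/-- A linear functional which is nonnegative on the elements `a* a`, as a positive linear map for
the spectral order of the C*-algebra; this gives access to the GNS construction. -/
noncomputable def toPositiveLinearMap (hφ : ∀ a, 0 ≤ φ (star a * a)) : A →ₚ[ℂ] ℂ :=
  .mk₀ (φ : A →ₗ[ℂ] ℂ) fun a ha => by
    obtain ⟨b, rfl⟩ := CStarAlgebra.nonneg_iff_eq_star_mul_self.1 ha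
    exact hφ b

theorem apply_star_eq_conj (hφ : ∀ a, 0 ≤ φ (star a * a)) (a : A) : φ (star a) = conj (φ a) :=
  map_star (toPositiveLinearMap hφ) a

theorem norm_apply_star_mul_le (hφ : ∀ a, 0 ≤ φ (star a * a)) (x y : A) :
    ‖φ (star x * y)‖ ≤ √(φ (star x * x)).re * √(φ (star y * y)).re :=
  let f := toPositiveLinearMap hφ
  norm_inner_le_norm (𝕜 := ℂ) (f.toPreGNS x) (f.toPreGNS y)

theorem norm_apply_star_mul_mul_le (hφ : ∀ a, 0 ≤ φ (star a * a)) (x a y : A) :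
    ‖φ (star x * a * y)‖ ≤ ‖a‖ * (√(φ (star x * x)).re * √(φ (star y * y)).re) := by
  let f := toPositiveLinearMap hφ
  have hay : ‖f.toPreGNS (a * y)‖ ≤ ‖a‖ * ‖f.toPreGNS y‖ :=
    (f.leftMulMapPreGNS a).le_of_opNorm_le
      (LinearMap.mkContinuous_norm_le _ (norm_nonneg a) _) (f.toPreGNS y)
  calc ‖φ (star x * a * y)‖
      ≤ ‖f.toPreGNS x‖ * ‖f.toPreGNS (a * y)‖ := by
        rw [mul_assoc]
        exact norm_apply_star_mul_le hφ x (a * y)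
    _ ≤ ‖f.toPreGNS x‖ * (‖a‖ * ‖f.toPreGNS y‖) := by gcongr
    _ = _ := mul_left_comm _ _ _

theorem norm_apply_mul_mul_le_of_isStarProjection (hφ : ∀ a, 0 ≤ φ (star a * a)) {p q : A}
    (hp : IsStarProjection p) (hq : IsStarProjection q) (a : A) :
    ‖φ (p * a * q)‖ ≤ ‖a‖ * (√(φ p).re * √(φ q).re) := by
  simpa only [hp.isSelfAdjoint.star_eq, hp.isIdempotentElem.eq, hq.isSelfAdjoint.star_eq,
    hq.isIdempotentElem.eq] using norm_apply_star_mul_mul_le hφ p a q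

theorem norm_apply_mul_mul_le_of_mul_mul_eq_zero (hφ : ∀ a, 0 ≤ φ (star a * a)) {p q r a : A}
    (hp : IsStarProjection p) (hqr : IsStarProjection (q - r)) (h : p * a * r = 0) :
    ‖φ (p * a * q)‖ ≤ ‖a‖ * (√(φ p).re * √(φ q - φ r).re) := by
  simpa only [mul_sub, h, sub_zero, map_sub] using
    norm_apply_mul_mul_le_of_isStarProjection hφ hp hqr a

theorem norm_apply_sub_apply_compl_mul_mul_compl_le (hφ : ∀ a, 0 ≤ φ (star a * a)) {q : A}
    (hq : IsStarProjection q) {s : ℝ} (hs : ∀ a, ‖φ ((1 - q) * a * q)‖ ≤ s * ‖a‖) (a : A) :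
    ‖φ a - φ ((1 - q) * a * (1 - q))‖ ≤ ((φ q).re + 2 * s) * ‖a‖ := by
  have hsplit : a - (1 - q) * a * (1 - q) =
      q * a * q + (1 - q) * a * q + star ((1 - q) * star a * q) := by
    simp only [star_mul, star_sub, star_one, star_star, hq.isSelfAdjoint.star_eq]
    noncomm_ring
  have hdiag : ‖φ (q * a * q)‖ ≤ (φ q).re * ‖a‖ := by
    have hre : 0 ≤ (φ q).re := (Complex.le_def.1 (apply_nonneg_of_isStarProjection hφ hq)).1
    simpa only [Real.mul_self_sqrt hre, mul_comm] using
      norm_apply_mul_mul_le_of_isStarProjection hφ hq hq a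
  have hadj : ‖φ (star ((1 - q) * star a * q))‖ ≤ s * ‖a‖ := by
    simpa only [apply_star_eq_conj hφ, RCLike.norm_conj, norm_star] using hs (star a)
  rw [← map_sub, hsplit, map_add, map_add]
  linarith [norm_add₃_le (a := φ (q * a * q)) (b := φ ((1 - q) * a * q))
    (c := φ (star ((1 - q) * star a * q))), hs a]

end PositiveFunctional

/-! ### Functionals with finitely many varying coefficients -/

section FiniteCoefficients

variable {𝕜 E F ι α : Type*} [NontriviallyNormedField 𝕜] [CompleteSpace 𝕜]
  [NormedAddCommGroup E] [NormedSpace 𝕜 E] {l : Filter α}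

theorem tendsto_zero_of_mem_of_disjoint_ker [NormedAddCommGroup F] [NormedSpace 𝕜 F]
    [FiniteDimensional 𝕜 F] {c : E →ₗ[𝕜] F} {V : Submodule 𝕜 E}
    (hV : Disjoint V (LinearMap.ker c)) {f : α → E} (hf : ∀ k, f k ∈ V)
    (hlim : Tendsto (fun k => c (f k)) l (𝓝 0)) : Tendsto f l (𝓝 0) := by
  have hinj : Function.Injective (c.domRestrict V) :=
    LinearMap.injective_domRestrict_iff.2 hV
  have : FiniteDimensional 𝕜 V := .of_injective (c.domRestrict V) hinj
  have hemb := LinearMap.isClosedEmbedding_of_injective (LinearMap.ker_eq_bot.2 hinj)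
  have hfV : Tendsto (fun k => (⟨f k, hf k⟩ : V)) l (𝓝 0) :=
    hemb.isInducing.tendsto_nhds_iff.2 (by simpa [Function.comp_def] using hlim)
  exact (continuous_subtype_val.tendsto (0 : V)).comp hfV

theorem tendsto_strongDual_of_eqOn_compl_finite {v : ι → E}
    (hv : Dense (Submodule.span 𝕜 (Set.range v) : Set E)) {s : Set ι} (hs : s.Finite)
    {f : α → StrongDual 𝕜 E} {g : StrongDual 𝕜 E} (hf : ∀ k, ∀ i ∉ s, f k (v i) = g (v i))
    (hlim : ∀ i ∈ s, Tendsto (fun k => f k (v i)) l (𝓝 (g (v i)))) : Tendsto f l (𝓝 g) := by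
  have := hs.fintype
  let coeff (i : ι) : StrongDual 𝕜 E →ₗ[𝕜] 𝕜 :=
    (ContinuousLinearMap.apply 𝕜 𝕜 (v i)).toLinearMap
  let vanishing : Submodule 𝕜 (StrongDual 𝕜 E) := ⨅ i ∈ sᶜ, LinearMap.ker (coeff i)
  have hmem {F : StrongDual 𝕜 E} : F ∈ vanishing ↔ ∀ i ∉ s, F (v i) = 0 := by
    simp [vanishing, coeff, Submodule.mem_iInf]
  have hdisj : Disjoint vanishing (LinearMap.ker (LinearMap.pi fun i : s => coeff i)) := by
    refine Submodule.disjoint_def.2 fun F hF hker => ?_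
    refine ContinuousLinearMap.ext_on hv (Set.eqOn_range.2 <| funext fun i => ?_)
    by_cases hi : i ∈ s
    · exact congrFun hker ⟨i, hi⟩
    · exact hmem.1 hF i hi
  refine tendsto_sub_nhds_zero_iff.1 (tendsto_zero_of_mem_of_disjoint_ker hdisj
    (fun k => hmem.2 fun i hi => sub_eq_zero.2 (hf k i hi)) (tendsto_pi_nhds.2 fun i => ?_))
  exact tendsto_sub_nhds_zero_iff.2 (hlim i i.2)

end FiniteCoefficients

/-! ### The generators of the Toeplitz algebra -/

-- With this instance `StarSubalgebra.cstarAlgebra` makes `𝒯` a C*-algebra.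
instance : IsClosed (𝒯 : Set (H →L[ℂ] H)) := StarSubalgebra.isClosed_topologicalClosure _

theorem norm_shift_apply (f : H) : ‖shift f‖ = ‖f‖ := by
  refine (sq_eq_sq₀ (norm_nonneg _) (norm_nonneg _)).1 ?_
  rw [norm_sq_eq, norm_sq_eq]
  change ∑' i, ‖shiftFun f i‖ ^ 2 = _
  rw [(shiftFun_summable f).tsum_eq_zero_add]
  simp [shiftFun]

theorem star_shift_mul_shift : star shift * shift = 1 :=
  (ContinuousLinearMap.norm_map_iff_adjoint_comp_self shift).1 norm_shift_apply

theorem star_genT_mul_genT : star genT * genT = 1 := Subtype.ext star_shift_mul_shift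

theorem T_zero_zero : T 0 0 = 1 := by simp [T]

theorem star_T (n m : ℕ) : star (T n m) = T m n := by simp [T]

theorem T_mul_T (a b c d : ℕ) : T a b * T c d = T (a + (c - b)) (b - c + d) :=
  pow_mul_pow_mul_pow_mul_pow_of_mul_eq_one star_genT_mul_genT a b c d

theorem isStarProjection_T_self (n : ℕ) : IsStarProjection (T n n) where
  isIdempotentElem := by rw [IsIdempotentElem, T_mul_T]; simp
  isSelfAdjoint := star_T n n

theorem isStarProjection_T_self_sub_T_self {m n : ℕ} (h : m ≤ n) :
    IsStarProjection (T m m - T n n) :=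
  (isStarProjection_T_self n).sub_of_mul_eq_left (isStarProjection_T_self m) <| by
    rw [T_mul_T, Nat.sub_eq_zero_of_le h, add_zero, Nat.sub_add_cancel h]

theorem one_sub_T_self_mul_T {n a : ℕ} (h : n ≤ a) (b : ℕ) : (1 - T n n) * T a b = 0 := by
  rw [sub_mul, one_mul, T_mul_T, Nat.add_sub_cancel' h, Nat.sub_eq_zero_of_le h, zero_add, sub_self]

theorem T_mul_one_sub_T_self {n b : ℕ} (a : ℕ) (h : n ≤ b) : T a b * (1 - T n n) = 0 := by
  rw [mul_sub, mul_one, T_mul_T, Nat.sub_eq_zero_of_le h, add_zero, Nat.sub_add_cancel h, sub_self]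

theorem dense_span_T :
    Dense (Submodule.span ℂ (Set.range fun p : ℕ × ℕ => T p.1 p.2) : Set 𝒯) := by
  have hmap : (Submodule.span ℂ (Set.range fun p : ℕ × ℕ => T p.1 p.2)).map
      𝒯.toSubalgebra.toSubmodule.subtype =
        Submodule.span ℂ (Set.range fun p : ℕ × ℕ => shift ^ p.1 * star shift ^ p.2) := by
    rw [Submodule.map_span, ← Set.range_comp]
    rfl
  have hle := adjoin_singleton_le_span_of_star_mul_self (R := ℂ) star_shift_mul_shift
  rw [← hmap] at hle
  exact Subtype.dense_iff.2 (closure_mono hle)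

theorem ext_T {ρ φ : Dual𝒯} (h : ∀ n m, ρ (T n m) = φ (T n m)) : ρ = φ :=
  ContinuousLinearMap.ext_on dense_span_T (Set.eqOn_range.2 (funext fun p => h p.1 p.2))

theorem eventually_one_sub_T_self_mul_mul_T_self_eq_zero (n : ℕ) {a : 𝒯}
    (ha : a ∈ Submodule.span ℂ (Set.range fun p : ℕ × ℕ => T p.1 p.2)) :
    ∀ᶠ m in atTop, (1 - T n n) * a * T m m = 0 := by
  induction ha using Submodule.span_induction with
  | mem a ha =>
    obtain ⟨⟨c, d⟩, rfl⟩ := ha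
    filter_upwards [eventually_ge_atTop (n + d)] with m hm
    rw [mul_assoc, T_mul_T, one_sub_T_self_mul_T (by omega)]
  | zero => simp
  | add a b _ _ iha ihb =>
    filter_upwards [iha, ihb] with m hma hmb
    rw [mul_add, add_mul, hma, hmb, add_zero]
  | smul z a _ ih =>
    filter_upwards [ih] with m hm
    rw [mul_smul_comm, smul_mul_assoc, hm, smul_zero]

/-! ### Convolution -/

theorem conv_T (ρ φ : Dual𝒯) (n m : ℕ) : conv ρ φ (T n m) = ρ (T n m) * φ (T n m) := by
  rw [conv_apply, comul_T, tensorFunctional_tmul]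

theorem conv_apply_one (ρ φ : Dual𝒯) : conv ρ φ 1 = ρ 1 * φ 1 := by
  rw [← T_zero_zero, conv_T]

theorem norm_comul_le (a : 𝒯) : ‖comul a‖ ≤ ‖a‖ := norm_ampOp_le diagEquiv a

theorem norm_conv_le (ρ φ : Dual𝒯) : ‖conv ρ φ‖ ≤ ‖ρ‖ * ‖φ‖ := by
  refine ContinuousLinearMap.opNorm_le_bound _ (by positivity) fun a => ?_
  exact (tensorFunctional ρ φ).le_of_opNorm_le_of_le (norm_tensorFunctional_le ρ φ)
    (norm_comul_le a)

theorem convPowSucc_T (ρ : Dual𝒯) (k n m : ℕ) :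
    convPowSucc ρ k (T n m) = ρ (T n m) ^ (k + 1) := by
  induction k with
  | zero => simp [convPowSucc]
  | succ k ih => rw [convPowSucc, conv_T, ih, ← pow_succ]

theorem norm_convPowSucc_le (ρ : Dual𝒯) (k : ℕ) : ‖convPowSucc ρ k‖ ≤ ‖ρ‖ ^ (k + 1) := by
  induction k with
  | zero => simp [convPowSucc]
  | succ k ih =>
    calc ‖convPowSucc ρ (k + 1)‖ ≤ ‖convPowSucc ρ k‖ * ‖ρ‖ := norm_conv_le _ _
      _ ≤ ‖ρ‖ ^ (k + 1) * ‖ρ‖ := by gcongr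
      _ = ‖ρ‖ ^ (k + 1 + 1) := (pow_succ _ _).symm

theorem tendsto_convPowSucc_zero {ρ : Dual𝒯} (hρ : ‖ρ‖ < 1) :
    Tendsto (convPowSucc ρ) atTop (𝓝 0) :=
  squeeze_zero_norm (E := Dual𝒯) (norm_convPowSucc_le ρ) <|
    (tendsto_pow_atTop_nhds_zero_of_lt_one (norm_nonneg ρ) hρ).comp (tendsto_add_atTop_nat 1)

/-! ### The Haar functional -/

/-- The vector functional `A ↦ ⟪x, A x⟫` on `𝒯`. -/
noncomputable def vectorFunctional (x : H) : Dual𝒯 :=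
  innerSL ℂ x ∘L ContinuousLinearMap.apply ℂ H x ∘L 𝒯.toSubalgebra.toSubmodule.subtypeL

theorem vectorFunctional_apply (x : H) (a : 𝒯) :
    vectorFunctional x a = ⟪x, (a : H →L[ℂ] H) x⟫_ℂ := rfl

theorem vectorFunctional_star_mul_self_nonneg (x : H) (a : 𝒯) :
    0 ≤ vectorFunctional x (star a * a) := by
  have h : vectorFunctional x (star a * a) = ⟪(a : H →L[ℂ] H) x, (a : H →L[ℂ] H) x⟫_ℂ :=
    ContinuousLinearMap.adjoint_inner_right (a : H →L[ℂ] H) _ _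
  rw [h, inner_self_eq_norm_sq_to_K]
  positivity

theorem isState_vectorFunctional {x : H} (hx : ‖x‖ = 1) : IsState (vectorFunctional x) := by
  refine ⟨vectorFunctional_star_mul_self_nonneg x, ?_⟩
  exact (inner_self_eq_norm_sq_to_K x).trans (by simp [hx])

theorem star_shift_single_zero (c : ℂ) : star shift (lp.single 2 0 c : H) = 0 := by
  refine ext_inner_right ℂ fun y => ?_
  rw [ContinuousLinearMap.star_eq_adjoint, ContinuousLinearMap.adjoint_inner_left,
    lp.inner_single_left, shift_apply, inner_zero_left]
  exact inner_zero_right _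

/-- The Haar functional, realised as the vacuum state `A ↦ ⟪e₀, A e₀⟫`. -/
noncomputable def haar : Dual𝒯 := vectorFunctional (lp.single 2 0 1)

theorem isState_haar : IsState haar := isState_vectorFunctional (by simp)

theorem haar_T_of_snd_ne_zero (n : ℕ) {m : ℕ} (hm : m ≠ 0) : haar (T n m) = 0 := by
  obtain ⟨k, rfl⟩ := Nat.exists_eq_succ_of_ne_zero hm
  have h : ((T n (k + 1) : 𝒯) : H →L[ℂ] H) (lp.single 2 0 1) =
      (shift ^ n * star shift ^ k) (star shift (lp.single 2 0 1)) := by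
    rw [T, pow_succ, ← mul_assoc]
    rfl
  rw [haar, vectorFunctional_apply, h, star_shift_single_zero, map_zero, inner_zero_right]

theorem haar_T (n m : ℕ) : haar (T n m) = if (n, m) = (0, 0) then 1 else 0 := by
  rcases eq_or_ne m 0 with rfl | hm
  · rcases eq_or_ne n 0 with rfl | hn
    · rw [T_zero_zero, isState_haar.2, if_pos rfl]
    · rw [← star_T, apply_star_eq_conj isState_haar.1, haar_T_of_snd_ne_zero 0 hn, map_zero,
        if_neg (by simp [hn])]
  · rw [haar_T_of_snd_ne_zero n hm, if_neg (by simp [hm])]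

theorem isHaarFunctional_haar : IsHaarFunctional haar := by
  refine ⟨isState_haar, fun ρ => ⟨ρ 1, ext_T fun n m => ?_, ext_T fun n m => ?_⟩⟩ <;>
  · rw [conv_T, _root_.smul_apply, haar_T, smul_eq_mul]
    split_ifs with h
    · obtain ⟨rfl, rfl⟩ := Prod.ext_iff.1 h
      simp [T_zero_zero]
    · simp

theorem IsHaarFunctional.conv_left {h : Dual𝒯} (hh : IsHaarFunctional h) (ρ : Dual𝒯) :
    conv h ρ = ρ 1 • h := by
  obtain ⟨c, hc, -⟩ := hh.2 ρ
  have hc1 : ρ 1 = c := by simpa [conv_apply_one, hh.1.2] using congrArg (· 1) hc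
  rw [hc, hc1]

theorem IsHaarFunctional.conv_right {h : Dual𝒯} (hh : IsHaarFunctional h) (ρ : Dual𝒯) :
    conv ρ h = ρ 1 • h := by
  obtain ⟨c, -, hc⟩ := hh.2 ρ
  have hc1 : ρ 1 = c := by simpa [conv_apply_one, hh.1.2] using congrArg (· 1) hc
  rw [hc, hc1]

theorem IsHaarFunctional.eq {h h' : Dual𝒯} (hh : IsHaarFunctional h)
    (hh' : IsHaarFunctional h') : h = h' := by
  simpa only [hh.1.2, hh'.1.2, one_smul] using (hh.conv_left h').symm.trans (hh'.conv_right h)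

/-! ### States on the Toeplitz algebra -/

section State

variable {ρ : Dual𝒯}

theorem T_self_nonneg (hρ : ∀ a, 0 ≤ ρ (star a * a)) (n : ℕ) : 0 ≤ (ρ (T n n)).re :=
  (Complex.le_def.1 (apply_nonneg_of_isStarProjection hρ (isStarProjection_T_self n))).1

theorem antitone_T_self (hρ : ∀ a, 0 ≤ ρ (star a * a)) : Antitone fun n => (ρ (T n n)).re :=
  fun m n hmn => by
    have h := apply_nonneg_of_isStarProjection hρ (isStarProjection_T_self_sub_T_self hmn)
    rw [map_sub, sub_nonneg] at h
    exact Complex.re_le_re h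

theorem norm_T_le (hρ : ∀ a, 0 ≤ ρ (star a * a)) (n m : ℕ) :
    ‖ρ (T n m)‖ ≤ √(ρ (T n n)).re * √(ρ (T m m)).re := by
  simpa only [T, star_pow, star_star] using
    norm_apply_star_mul_le hρ (star genT ^ n) (star genT ^ m)

theorem IsState.T_self_le_one (hρ : IsState ρ) (n : ℕ) : (ρ (T n n)).re ≤ 1 := by
  simpa [T_zero_zero, hρ.2] using antitone_T_self hρ.1 n.zero_le

theorem IsState.norm_apply_one_sub_T_self_mul_mul_T_self_le (hρ : IsState ρ) (n : ℕ) (a : 𝒯) :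
    ‖ρ ((1 - T n n) * a * T n n)‖ ≤ √((ρ (T n n)).re - ⨅ m, (ρ (T m m)).re) * ‖a‖ := by
  refine dense_span_T.induction (fun b hb => ?_) (isClosed_le (by fun_prop) (by fun_prop)) a
  obtain ⟨m, hm, hnm⟩ := ((eventually_one_sub_T_self_mul_mul_T_self_eq_zero n hb).and
    (eventually_ge_atTop n)).exists
  have hp : √(ρ (1 - T n n)).re ≤ 1 := by
    rw [map_sub, hρ.2, Complex.sub_re, Complex.one_re]
    exact Real.sqrt_le_one.2 (by linarith [T_self_nonneg hρ.1 n])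
  have hq : √(ρ (T n n) - ρ (T m m)).re ≤ √((ρ (T n n)).re - ⨅ m, (ρ (T m m)).re) := by
    rw [Complex.sub_re]
    have hbdd : BddBelow (Set.range fun m => (ρ (T m m)).re) :=
      ⟨0, Set.forall_mem_range.2 (T_self_nonneg hρ.1)⟩
    exact Real.sqrt_le_sqrt (sub_le_sub_left (ciInf_le hbdd m) _)
  calc ‖ρ ((1 - T n n) * b * T n n)‖
      ≤ ‖b‖ * (√(ρ (1 - T n n)).re * √(ρ (T n n) - ρ (T m m)).re) :=
        norm_apply_mul_mul_le_of_mul_mul_eq_zero hρ.1 (isStarProjection_T_self n).one_sub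
          (isStarProjection_T_self_sub_T_self hnm) hm
    _ ≤ ‖b‖ * (1 * √((ρ (T n n)).re - ⨅ m, (ρ (T m m)).re)) := by gcongr
    _ = _ := by rw [one_mul, mul_comm]

/-- The compression `A ↦ P A P` by the projection `P = 1 - T n n` onto the span of
`e₀, …, eₙ₋₁`. -/
noncomputable def compression (n : ℕ) : 𝒯 →L[ℂ] 𝒯 :=
  ContinuousLinearMap.mulLeftRight ℂ 𝒯 (1 - T n n) (1 - T n n)

theorem compression_apply (n : ℕ) (a : 𝒯) :
    compression n a = (1 - T n n) * a * (1 - T n n) := rfl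

theorem compression_T {n a b : ℕ} (h : n ≤ a ∨ n ≤ b) : compression n (T a b) = 0 := by
  rw [compression_apply]
  rcases h with h | h
  · rw [one_sub_T_self_mul_T h, zero_mul]
  · rw [mul_assoc, T_mul_one_sub_T_self a h, mul_zero]

theorem IsState.norm_sub_comp_compression_le (hρ : IsState ρ) (n : ℕ) :
    ‖ρ - ρ ∘L compression n‖ ≤
      (ρ (T n n)).re + 2 * √((ρ (T n n)).re - ⨅ m, (ρ (T m m)).re) :=
  ContinuousLinearMap.opNorm_le_bound _ (add_nonneg (T_self_nonneg hρ.1 n) (by positivity))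
    (norm_apply_sub_apply_compl_mul_mul_compl_le hρ.1 (isStarProjection_T_self n)
      (hρ.norm_apply_one_sub_T_self_mul_mul_T_self_le n))

theorem IsState.T_self_lt_one (hρ : IsState ρ) (h1 : ρ (T 1 1) ≠ 1) {n : ℕ} (hn : n ≠ 0) :
    (ρ (T n n)).re < 1 := by
  have him : (ρ (T 1 1)).im = 0 :=
    (Complex.le_def.1 (apply_nonneg_of_isStarProjection hρ.1 (isStarProjection_T_self 1))).2.symm
  have hlt : (ρ (T 1 1)).re < 1 :=
    (hρ.T_self_le_one 1).lt_of_ne fun hre => h1 (Complex.ext hre him)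
  exact (antitone_T_self hρ.1 (Nat.one_le_iff_ne_zero.2 hn)).trans_lt hlt

theorem IsState.norm_T_lt_one (hρ : IsState ρ) (h1 : ρ (T 1 1) ≠ 1) {n m : ℕ}
    (hnm : (n, m) ≠ (0, 0)) : ‖ρ (T n m)‖ < 1 := by
  refine (norm_T_le hρ.1 n m).trans_lt ?_
  have hle (k : ℕ) : √(ρ (T k k)).re ≤ 1 := Real.sqrt_le_one.2 (hρ.T_self_le_one k)
  have hlt {k : ℕ} (hk : k ≠ 0) : √(ρ (T k k)).re < 1 :=
    (Real.sqrt_lt' one_pos).2 (by simpa using hρ.T_self_lt_one h1 hk)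
  rcases eq_or_ne n 0 with rfl | hn
  · have hm : m ≠ 0 := fun hm => hnm (by rw [hm])
    exact mul_lt_one_of_nonneg_of_lt_one_right (hle 0) (Real.sqrt_nonneg _) (hlt hm)
  · exact mul_lt_one_of_nonneg_of_lt_one_left (Real.sqrt_nonneg _) (hlt hn) (hle m)

theorem IsState.exists_norm_sub_comp_compression_lt_one (hρ : IsState ρ) (h1 : ρ (T 1 1) ≠ 1) :
    ∃ n, ‖ρ - ρ ∘L compression n‖ < 1 := by
  have hbdd : BddBelow (Set.range fun n => (ρ (T n n)).re) :=
    ⟨0, Set.forall_mem_range.2 (T_self_nonneg hρ.1)⟩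
  set c := ⨅ n, (ρ (T n n)).re
  have hc : c < 1 := (ciInf_le hbdd 1).trans_lt (hρ.T_self_lt_one h1 one_ne_zero)
  have hT : Tendsto (fun n => (ρ (T n n)).re) atTop (𝓝 c) :=
    tendsto_atTop_ciInf (antitone_T_self hρ.1) hbdd
  have hbound : Tendsto (fun n => (ρ (T n n)).re + 2 * √((ρ (T n n)).re - c)) atTop (𝓝 c) := by
    simpa using hT.add ((hT.sub_const c).sqrt.const_mul 2)
  obtain ⟨n, hn⟩ := (hbound.eventually_lt_const hc).exists
  exact ⟨n, (hρ.norm_sub_comp_compression_le n).trans_lt hn⟩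

theorem tendsto_convPowSucc_T (hone : ρ 1 = 1)
    (hlt : ∀ n m, (n, m) ≠ (0, 0) → ‖ρ (T n m)‖ < 1) (n m : ℕ) :
    Tendsto (fun k => convPowSucc ρ k (T n m)) atTop (𝓝 (haar (T n m))) := by
  simp only [convPowSucc_T, haar_T]
  split_ifs with h
  · obtain ⟨rfl, rfl⟩ := Prod.ext_iff.1 h
    simp [T_zero_zero, hone]
  · exact (tendsto_pow_atTop_nhds_zero_of_norm_lt_one (hlt n m h)).comp (tendsto_add_atTop_nat 1)

theorem tendsto_convPowSucc_haar_of_norm_lt_one {τ : Dual𝒯} (hone : ρ 1 = 1)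
    (hlt : ∀ n m, (n, m) ≠ (0, 0) → ‖ρ (T n m)‖ < 1) (hτ : ‖τ‖ < 1)
    (hfin : {p : ℕ × ℕ | τ (T p.1 p.2) ≠ ρ (T p.1 p.2)}.Finite) :
    Tendsto (convPowSucc ρ) atTop (𝓝 haar) := by
  have hτ0 := tendsto_convPowSucc_zero hτ
  have hsub : Tendsto (fun k => convPowSucc ρ k - convPowSucc τ k) atTop (𝓝 haar) := by
    refine tendsto_strongDual_of_eqOn_compl_finite dense_span_T (hfin.insert (0, 0))
      (fun k p hp => ?_) (fun p _ => ?_)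
    · rw [Set.mem_insert_iff, not_or, Set.mem_ofPred_eq, not_not] at hp
      rw [_root_.sub_apply, convPowSucc_T, convPowSucc_T, hp.2, sub_self, haar_T, if_neg hp.1]
    · have hτp : Tendsto (fun k => convPowSucc τ k (T p.1 p.2)) atTop (𝓝 0) :=
        ((ContinuousLinearMap.apply ℂ ℂ (T p.1 p.2)).continuous.tendsto' 0 0 (map_zero _)).comp hτ0
      simpa using (tendsto_convPowSucc_T hone hlt p.1 p.2).sub hτp
  simpa using hsub.add hτ0

theorem IsState.tendsto_convPowSucc (hρ : IsState ρ) (h1 : ρ (T 1 1) ≠ 1) :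
    Tendsto (convPowSucc ρ) atTop (𝓝 haar) := by
  obtain ⟨n, hn⟩ := hρ.exists_norm_sub_comp_compression_lt_one h1
  refine tendsto_convPowSucc_haar_of_norm_lt_one hρ.2
    (fun _ _ hnm => hρ.norm_T_lt_one h1 hnm) hn ?_
  refine ((Set.finite_Iio n).prod (Set.finite_Iio n)).subset fun p hp => ?_
  contrapose! hp
  have hbox : n ≤ p.1 ∨ n ≤ p.2 := by
    simpa only [Set.mem_prod, Set.mem_Iio, not_and_or, not_lt] using hp
  simp [compression_T hbox]

theorem tendsto_cesaro {φ : Dual𝒯} (h : Tendsto (convPowSucc ρ) atTop (𝓝 φ)) :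
    Tendsto (cesaro ρ) atTop (𝓝 φ) := by
  refine (Filter.Tendsto.cesaro_smul (E := Dual𝒯) h).congr fun N => ?_
  rw [cesaro, ← Complex.coe_smul, Complex.ofReal_inv, Complex.ofReal_natCast]

theorem IsFaithful.apply_T_one_one_ne_one (hf : IsFaithful ρ) (hone : ρ 1 = 1) :
    ρ (T 1 1) ≠ 1 := by
  intro h
  have hp := (isStarProjection_T_self 1).one_sub
  have hzero : 1 - T 1 1 = 0 := hf _ <| by
    rw [hp.isSelfAdjoint.star_eq, hp.isIdempotentElem.eq, map_sub, h, hone, sub_self]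
  have hhaar := congrArg haar hzero
  simp [isState_haar.2, haar_T] at hhaar

end State

end Toeplitz

open Toeplitz in
theorem mainTheorem7_general :
    (∃! h : Dual𝒯, IsHaarFunctional h) ∧
    ∀ h : Dual𝒯, IsHaarFunctional h → ∀ ρ : Dual𝒯, IsState ρ → ρ (T 1 1) ≠ 1 →
      (∀ n m : ℕ, (n, m) ≠ (0, 0) → ‖ρ (T n m)‖ < 1) ∧
      (∀ n m : ℕ, h (T n m) = if (n, m) = (0, 0) then 1 else 0) ∧
      Tendsto (convPowSucc ρ) atTop (𝓝 h) ∧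
      (∀ n m : ℕ, Tendsto (fun N => cesaro ρ N (T n m)) atTop (𝓝 (h (T n m)))) ∧
      (∀ A : 𝒯, Tendsto (fun N => cesaro ρ N A) atTop (𝓝 (h A))) ∧
      Tendsto (fun N => cesaro ρ N) atTop (𝓝 h) := by
  refine ⟨⟨haar, isHaarFunctional_haar, fun h hh => hh.eq isHaarFunctional_haar⟩, ?_⟩
  intro h hh ρ hρ h1
  obtain rfl : h = haar := hh.eq isHaarFunctional_haar
  have hpow := hρ.tendsto_convPowSucc h1
  have hnorm := tendsto_cesaro hpow
  have hpointwise (A : 𝒯) : Tendsto (fun N => cesaro ρ N A) atTop (𝓝 (haar A)) :=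
    ((ContinuousLinearMap.apply ℂ ℂ A).continuous.tendsto haar).comp hnorm
  exact ⟨fun n m hnm => hρ.norm_T_lt_one h1 hnm, haar_T, hpow,
    fun n m => hpointwise (T n m), hpointwise, hnorm⟩

open Toeplitz in
/-- There is exactly one Haar functional `h` in `𝒯*`; and if `ρ` is a faithful state on `𝒯`, then
`|ρ(T_{n,m})| < 1` for `(n,m) ≠ (0,0)`, and the Cesàro means `ρ_N = (1/N) ∑_{k=1}^N ρ^{∗k}`
converge to `h`: on each generator `T_{n,m}`, with the limit `h(T_{n,m})` equal to `1` if
`(n,m) = (0,0)` and to `0` otherwise; at each `A ∈ 𝒯`; and in the norm of `𝒯*`. -/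
theorem mainTheorem7 :
    (∃! h : Dual𝒯, IsHaarFunctional h) ∧
    ∀ h : Dual𝒯, IsHaarFunctional h → ∀ ρ : Dual𝒯, IsState ρ → IsFaithful ρ →
      (∀ n m : ℕ, (n, m) ≠ (0, 0) → ‖ρ (T n m)‖ < 1) ∧
      (∀ n m : ℕ, h (T n m) = if (n, m) = (0, 0) then 1 else 0) ∧
      (∀ n m : ℕ, Tendsto (fun N => cesaro ρ N (T n m)) atTop (𝓝 (h (T n m)))) ∧
      (∀ A : 𝒯, Tendsto (fun N => cesaro ρ N A) atTop (𝓝 (h A))) ∧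
      Tendsto (fun N => cesaro ρ N) atTop (𝓝 h) := by
  refine ⟨mainTheorem7_general.1, fun h hh ρ hρ hf => ?_⟩
  obtain ⟨hlt, hT, -, hcesaro⟩ :=
    mainTheorem7_general.2 h hh ρ hρ (hf.apply_T_one_one_ne_one hρ.2)
  exact ⟨hlt, hT, hcesaro⟩
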